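/- Let $A$ be a locally compact Hausdorff Abelian group (written additively) with dual group $\widehat A$ of continuous characters $\xi:A\to U(1)$. Fix a (Radon) Haar measure on $A$, give $\widehat A$ the Haar measure for which the Fourier inversion formula holds with constant $1$, and give $A\times\widehat A$ the Radon product measure. Let $\mathcal H$ be a Hilbert space with a unitary operator $U:\mathcal H\to L^2(A)$. For $(x,\xi)\in A\times\widehat A$ let $\pi(x,\xi)\psi(y)=\xi(y)\psi(y-x)$ on $L^2(A)$ and $W(x,\xi)=U^{-1}\pi(x,\xi)U$. Let $\mathbb H_A=\{u\,W(z): u\in U(1),\ z\in A\times\widehat A\}$ be the Heisenberg group, with composition of operators as group law and with the topology induced by the bijection $\mathbb H_A\simeq U(1)\times A\times\widehat A$. Let $\mathfrak G$ be the collection of the compact subgroups $\mathcal G\subset\mathbb H_A$ such that the homomorphism $\mathcal G\to A\times\widehat A$, $u\,W(z)\mapsto z$, is injective and has an image of measure $1$. A subgroup $K\subset A\times\widehat A$ is isotropic if $\xi(y)\overline{\eta(x)}=1$ for all $(x,\xi),(y,\eta)\in K$; a maximal compact open isotropic subgroup is a compact open isotropic subgroup that is not strictly contained in any other one. If $\beta:K\to\widehat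 K$ is a continuous homomorphism with $\beta(z)(w)=\beta(w)(z)$, a character of second degree of $K$ associated with $\beta$ is a continuous function $\alpha:K\to U(1)$ with $\alpha(z+w)=\alpha(z)\alpha(w)\beta(z)(w)$ for $z,w\in K$; the set of all characters of second degree of $K$ is denoted by $\mathrm{Ch}_2(K)$. **Proposition.** A subset $\mathcal G\subset\mathbb H_A$ belongs to $\mathfrak G$ if and only if $$\mathcal G=\{\alpha(z)W(z): z\in K\}$$ for some maximal compact open isotropic subgroup $K\subset A\times\widehat A$ and some $\alpha\in\mathrm{Ch}_2(K)$ associated with the continuous symmetric homomorphism $\beta':K\to\widehat K$ given by $\beta'(x,\xi)(y,\eta)=\overline{\eta(x)}$, that is, some continuous $\alpha:K\to U(1)$ with $$\alpha(x+y,\xi+\eta)=\alpha(x,\xi)\,\alpha(y,\eta)\,\overline{\eta(x)}\qquad\text{for } (x,\xi),(y,\eta)\in K.$$ Moreover, if $A$ is finite, of cardinality $N$, then every $\mathcal G\in\mathfrak G$ is contained in the Pauli group $\mathbb P_A=\{\zeta^kW(z): k\in\mathbb Z,\ z\in A\times\widehat A\}$, where $\zeta=\exp(\pi i/N)$. -/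

import Mathlib

open MeasureTheory
open scoped ENNReal CompactlySupported

set_option linter.unusedSectionVars false

noncomputable section

namespace WeylHeisenberg

/-- The phase space `A × Â`, a topological group (all group laws are written multiplicatively). -/
abbrev PhaseSpace (A : Type*) [CommGroup A] [TopologicalSpace A] : Type _ :=
  A × PontryaginDual A

/-! ### Haar measures on the dual group and on the phase space -/

section Measures

variable {A : Type*} [CommGroup A] [TopologicalSpace A] [MeasurableSpace A]

/-- The Fourier transform `ξ ↦ ∫ conj (ξ x) f x dx`. -/
def fourierTransform (μ : Measure A) (f : A → ℂ) (ξ : PontryaginDual A) : ℂ :=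
  ∫ x, starRingEnd ℂ (ξ x : ℂ) * f x ∂μ

/-- The Fourier inversion formula for the measures `μ` on `A` and `ν` on `Â` holds with constant
`1`; for a Haar measure `ν` this fixes the normalization of `ν` in terms of that of `μ`. -/
def FourierInversion [MeasurableSpace (PontryaginDual A)]
    (μ : Measure A) (ν : Measure (PontryaginDual A)) : Prop :=
  ∀ f : A → ℂ, Continuous f → Integrable f μ → Integrable (fourierTransform μ f) ν →
    ∀ x : A, f x = ∫ ξ, (ξ x : ℂ) * fourierTransform μ f ξ ∂ν

end Measures

section RadonProduct

variable {X Y : Type*} [TopologicalSpace X] [TopologicalSpace Y]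
  [MeasurableSpace X] [MeasurableSpace Y] [BorelSpace X] [BorelSpace Y]
  [T2Space X] [T2Space Y] (μ : Measure X) (ν : Measure Y)
  [IsFiniteMeasureOnCompacts μ] [IsFiniteMeasureOnCompacts ν]

theorem integrable_slice (f : C_c(X × Y, ℝ)) (x : X) :
    Integrable (fun y => f (x, y)) ν := by
  have hc : Continuous (fun y => f (x, y)) := f.continuous.comp (by fun_prop)
  refine hc.integrable_of_hasCompactSupport ?_
  refine HasCompactSupport.of_support_subset_isCompact
    (f.hasCompactSupport.isCompact.image continuous_snd) ?_
  intro y hy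
  exact ⟨(x, y), subset_tsupport _ hy, rfl⟩

theorem integrable_integral_slice (f : C_c(X × Y, ℝ)) :
    Integrable (fun x => ∫ y, f (x, y) ∂ν) μ := by
  have hK := f.hasCompactSupport.isCompact
  have hc : Continuous (fun x => ∫ y, f (x, y) ∂ν) := by
    rw [← continuousOn_univ]
    refine continuousOn_integral_of_compact_support (f := fun x y => f (x, y))
      (hK.image continuous_snd) f.continuous.continuousOn ?_
    intro x y _ hy
    by_contra h
    exact hy ⟨(x, y), subset_tsupport _ h, rfl⟩
  refine hc.integrable_of_hasCompactSupport ?_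
  refine HasCompactSupport.of_support_subset_isCompact (hK.image continuous_fst) ?_
  intro x hx
  by_contra h
  refine hx ?_
  have : (fun y => f (x, y)) = fun _ => 0 := by
    funext y
    by_contra h'
    exact h ⟨(x, y), subset_tsupport _ h', rfl⟩
  simp [this]

/-- The iterated integral `f ↦ ∫ (∫ f (x, y) dν(y)) dμ(x)` as a positive functional on
`C_c(X × Y)`. -/
def iteratedIntegral : C_c(X × Y, ℝ) →ₚ[ℝ] ℝ :=
  PositiveLinearMap.mk₀
    { toFun := fun f => ∫ x, ∫ y, f (x, y) ∂ν ∂μ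
      map_add' := by
        intro f g
        rw [← integral_add (integrable_integral_slice μ ν f) (integrable_integral_slice μ ν g)]
        congr 1
        funext x
        exact integral_add (integrable_slice ν f x) (integrable_slice ν g x)
      map_smul' := by
        intro c f
        simp [integral_const_mul] }
    (by
      intro f hf
      exact integral_nonneg fun x => integral_nonneg fun y => hf (x, y))

/-- The Radon product of `μ` and `ν`: the regular measure on the Borel sets of `X × Y` that
represents the iterated integral on `C_c(X × Y)`. (Without countability assumptions the Borel
`σ`-algebra of `X × Y` may be larger than the product `σ`-algebra.) -/
def radonProduct [LocallyCompactSpace X] [LocallyCompactSpace Y] :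
    @Measure (X × Y) (borel (X × Y)) :=
  letI : MeasurableSpace (X × Y) := borel (X × Y)
  haveI : BorelSpace (X × Y) := ⟨rfl⟩
  RealRMK.rieszMeasure (iteratedIntegral μ ν)

end RadonProduct

/-! ### Isotropic subgroups -/

section Isotropic

variable {A : Type*} [CommGroup A] [TopologicalSpace A]

/-- The symplectic bicharacter `σ((x, ξ), (y, η)) = ξ(y) conj (η(x))`; on the unit circle complex
conjugation is the inverse. -/
def symplecticForm (z w : PhaseSpace A) : Circle := z.2 w.1 * (w.2 z.1)⁻¹

theorem symplecticForm_eq_one_iff {z w : PhaseSpace A} :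
    symplecticForm z w = 1 ↔ z.2 w.1 = w.2 z.1 := by
  rw [symplecticForm, mul_inv_eq_one]

def IsIsotropic (K : Subgroup (PhaseSpace A)) : Prop :=
  ∀ z ∈ K, ∀ w ∈ K, symplecticForm z w = 1

structure IsCompactOpenIsotropic (K : Subgroup (PhaseSpace A)) : Prop where
  isCompact : IsCompact (K : Set (PhaseSpace A))
  isOpen : IsOpen (K : Set (PhaseSpace A))
  isIsotropic : IsIsotropic K

/-- `K` is a compact open isotropic subgroup, not strictly contained in another one. -/
def IsMaximalCompactOpenIsotropic (K : Subgroup (PhaseSpace A)) : Prop :=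
  Maximal IsCompactOpenIsotropic K

theorem IsMaximalCompactOpenIsotropic.isIsotropic {K : Subgroup (PhaseSpace A)}
    (hK : IsMaximalCompactOpenIsotropic K) : IsIsotropic K :=
  hK.prop.isIsotropic

end Isotropic

/-! ### Characters of second degree -/

section SecondDegree

/-- `Sym(G)`: the continuous homomorphisms `β : G → Ĝ` with `β(x)(y) = β(y)(x)`. -/
def SymHom (G : Type*) [CommGroup G] [TopologicalSpace G] : Type _ :=
  {β : G →ₜ* PontryaginDual G // ∀ x y : G, β x y = β y x}

/-- `h` is a character of second degree of `G`, associated with `β`. -/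
structure IsSecondDegreeCharacter {G : Type*} [CommGroup G] [TopologicalSpace G]
    (h : G → Circle) (β : SymHom G) : Prop where
  continuous : Continuous h
  map_mul : ∀ x y : G, h (x * y) = h x * h y * β.1 x y

variable {A : Type*} [CommGroup A] [TopologicalSpace A] [IsTopologicalGroup A]
  [LocallyCompactSpace A]

instance pontryaginDualContinuousEval : ContinuousEval (PontryaginDual A) A Circle :=
  inferInstanceAs (ContinuousEval (A →ₜ* Circle) A Circle)

/-- The symmetric homomorphism `β'((x, ξ))((y, η)) = conj (η(x))` of an isotropic subgroup `K`. -/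
def betaPrime (K : Subgroup (PhaseSpace A)) (hK : IsIsotropic K) : SymHom K :=
  ⟨{ toFun := fun z =>
      (show K →ₜ* Circle from
       { toFun := fun w => ((w : PhaseSpace A).2 (z : PhaseSpace A).1)⁻¹
         map_one' := by simp
         map_mul' := by
           intro v w
           show ((v : PhaseSpace A).2 (z : PhaseSpace A).1 *
             (w : PhaseSpace A).2 (z : PhaseSpace A).1)⁻¹ = _
           rw [mul_inv]
         continuous_toFun := by fun_prop })
     map_one' := by
      refine PontryaginDual.ext fun w => ?_
      show ((w : PhaseSpace A).2 1)⁻¹ = 1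
      simp
     map_mul' := by
      intro v z
      refine PontryaginDual.ext fun w => ?_
      show ((w : PhaseSpace A).2 ((v : PhaseSpace A).1 * (z : PhaseSpace A).1))⁻¹ =
        ((w : PhaseSpace A).2 (v : PhaseSpace A).1)⁻¹ *
          ((w : PhaseSpace A).2 (z : PhaseSpace A).1)⁻¹
      rw [map_mul, mul_inv]
     continuous_toFun := by
      refine ContinuousMonoidHom.continuous_of_continuous_uncurry _ ?_
      show Continuous fun p : K × K =>
        ((p.2 : PhaseSpace A).2 (p.1 : PhaseSpace A).1)⁻¹
      fun_prop },
   fun z w => by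
    show ((w : PhaseSpace A).2 (z : PhaseSpace A).1)⁻¹ =
      ((z : PhaseSpace A).2 (w : PhaseSpace A).1)⁻¹
    rw [symplecticForm_eq_one_iff.1 (hK z z.2 w w.2)]⟩

@[simp]
theorem betaPrime_apply (K : Subgroup (PhaseSpace A)) (hK : IsIsotropic K) (z w : K) :
    (betaPrime K hK).1 z w = ((w : PhaseSpace A).2 (z : PhaseSpace A).1)⁻¹ :=
  rfl

end SecondDegree

/-! ### Weyl–Heisenberg operators and the Heisenberg group -/

section Operators

variable {A : Type*} [CommGroup A] [TopologicalSpace A] [IsTopologicalGroup A]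
  [MeasurableSpace A] [BorelSpace A] {μ : Measure A} [μ.IsHaarMeasure]

theorem memLp_shift (z : PhaseSpace A) (ψ : Lp ℂ 2 μ) :
    MemLp (fun y => (z.2 y : ℂ) * ψ (y / z.1)) 2 μ := by
  have h1 : MemLp (fun y => ψ (y / z.1)) 2 μ :=
    (Lp.memLp ψ).comp_measurePreserving (measurePreserving_div_right μ z.1)
  have hc : Continuous (fun y => (z.2 y : ℂ)) :=
    continuous_subtype_val.comp (map_continuous z.2)
  refine h1.of_le (AEStronglyMeasurable.mul hc.aestronglyMeasurable h1.1) ?_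
  filter_upwards with y
  rw [norm_mul, Circle.norm_coe, one_mul]

/-- The phase-space shift `π(x, ξ) ψ(y) = ξ(y) ψ(y - x)` on `L²(A)`. -/
def shift (z : PhaseSpace A) (ψ : Lp ℂ 2 μ) : Lp ℂ 2 μ :=
  (memLp_shift z ψ).toLp (fun y => (z.2 y : ℂ) * ψ (y / z.1))

theorem coeFn_shift (z : PhaseSpace A) (ψ : Lp ℂ 2 μ) :
    shift z ψ =ᵐ[μ] fun y => (z.2 y : ℂ) * ψ (y / z.1) :=
  MemLp.coeFn_toLp _

theorem ae_div {p : A → Prop} (h : ∀ᵐ y ∂μ, p y) (x : A) : ∀ᵐ y ∂μ, p (y / x) :=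
  (measurePreserving_div_right μ x).quasiMeasurePreserving.ae h

theorem shift_shift (z w : PhaseSpace A) (ψ : Lp ℂ 2 μ) :
    shift z (shift w ψ) = (((w.2 z.1)⁻¹ : Circle) : ℂ) • shift (z * w) ψ := by
  refine Lp.ext ?_
  filter_upwards [coeFn_shift z (shift w ψ), ae_div (coeFn_shift w ψ) z.1,
    Lp.coeFn_smul (((w.2 z.1)⁻¹ : Circle) : ℂ) (shift (z * w) ψ),
    coeFn_shift (z * w) ψ] with y h1 h2 h3 h4
  rw [h1, h2, h3, Pi.smul_apply, h4, map_div, div_div, smul_eq_mul]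
  have : (z * w).2 y = z.2 y * w.2 y := rfl
  rw [this, Prod.fst_mul, div_eq_mul_inv, Circle.coe_mul, Circle.coe_mul]
  ring

theorem shift_one (ψ : Lp ℂ 2 μ) : shift (1 : PhaseSpace A) ψ = ψ := by
  refine Lp.ext ?_
  filter_upwards [coeFn_shift (1 : PhaseSpace A) ψ] with y h
  rw [h]
  simp

theorem shift_add (z : PhaseSpace A) (φ ψ : Lp ℂ 2 μ) :
    shift z (φ + ψ) = shift z φ + shift z ψ := by
  refine Lp.ext ?_
  filter_upwards [coeFn_shift z (φ + ψ), coeFn_shift z φ, coeFn_shift z ψ,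
    ae_div (Lp.coeFn_add φ ψ) z.1, Lp.coeFn_add (shift z φ) (shift z ψ)] with y h1 h2 h3 h4 h5
  rw [h1, h4, h5, Pi.add_apply, Pi.add_apply, h2, h3, mul_add]

theorem shift_smul (z : PhaseSpace A) (c : ℂ) (ψ : Lp ℂ 2 μ) :
    shift z (c • ψ) = c • shift z ψ := by
  refine Lp.ext ?_
  filter_upwards [coeFn_shift z (c • ψ), coeFn_shift z ψ,
    ae_div (Lp.coeFn_smul c ψ) z.1, Lp.coeFn_smul c (shift z ψ)] with y h1 h2 h3 h4
  rw [h1, h3, h4, Pi.smul_apply, Pi.smul_apply, h2, smul_eq_mul, smul_eq_mul]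
  ring

theorem norm_shift (z : PhaseSpace A) (ψ : Lp ℂ 2 μ) : ‖shift z ψ‖ = ‖ψ‖ := by
  rw [shift, Lp.norm_toLp, Lp.norm_def]
  congr 1
  rw [← eLpNorm_comp_measurePreserving (Lp.aestronglyMeasurable ψ)
    (measurePreserving_div_right μ z.1)]
  refine eLpNorm_congr_norm_ae ?_
  filter_upwards with y
  rw [norm_mul, Circle.norm_coe, one_mul, Function.comp_apply]

variable {ℋ : Type*} [NormedAddCommGroup ℋ] [InnerProductSpace ℂ ℋ]

/-- The operator `u W(z) = u U⁻¹ π(z) U` on `ℋ`, for a phase `u` and a point `z = (x, ξ)` of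
phase space; here `U : ℋ → L²(A)` is the given unitary operator. -/
def heisenbergOp (U : ℋ ≃ₗᵢ[ℂ] Lp ℂ 2 μ) (u : Circle) (z : PhaseSpace A) : ℋ ≃ₗᵢ[ℂ] ℋ where
  toFun φ := (u : ℂ) • U.symm (shift z (U φ))
  map_add' φ ψ := by simp [shift_add]
  map_smul' c φ := by simp [shift_smul, smul_comm c]
  invFun φ := ((u⁻¹ * (z.2 z.1)⁻¹ : Circle) : ℂ) • U.symm (shift z⁻¹ (U φ))
  left_inv φ := by
    have h : z.2 (z⁻¹ : PhaseSpace A).1 = (z.2 z.1)⁻¹ := map_inv z.2 z.1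
    simp only [map_smul, LinearIsometryEquiv.apply_symm_apply, shift_smul, shift_shift,
      inv_mul_cancel, shift_one, LinearIsometryEquiv.symm_apply_apply, smul_smul, h]
    rw [← Circle.coe_mul, ← Circle.coe_mul]
    have e : u⁻¹ * (z.2 z.1)⁻¹ * (u * ((z.2 z.1)⁻¹)⁻¹) = 1 := by
      rw [mul_comm u, ← mul_assoc]
      simp
    rw [e, Circle.coe_one, one_smul]
  right_inv φ := by
    have h : (z⁻¹ : PhaseSpace A).2 z.1 = (z.2 z.1)⁻¹ := rfl
    simp only [map_smul, LinearIsometryEquiv.apply_symm_apply, shift_smul, shift_shift,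
      mul_inv_cancel, shift_one, LinearIsometryEquiv.symm_apply_apply, smul_smul, h]
    rw [← Circle.coe_mul, ← Circle.coe_mul]
    simp
  norm_map' φ := by
    show ‖(u : ℂ) • U.symm (shift z (U φ))‖ = ‖φ‖
    rw [norm_smul, Circle.norm_coe, one_mul, LinearIsometryEquiv.norm_map, norm_shift,
      LinearIsometryEquiv.norm_map]

theorem heisenbergOp_apply (U : ℋ ≃ₗᵢ[ℂ] Lp ℂ 2 μ) (u : Circle) (z : PhaseSpace A) (φ : ℋ) :
    heisenbergOp U u z φ = (u : ℂ) • U.symm (shift z (U φ)) :=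
  rfl

theorem heisenbergOp_mul (U : ℋ ≃ₗᵢ[ℂ] Lp ℂ 2 μ) (u v : Circle) (z w : PhaseSpace A) :
    heisenbergOp U u z * heisenbergOp U v w =
      heisenbergOp U (u * v * (w.2 z.1)⁻¹) (z * w) := by
  refine LinearIsometryEquiv.ext fun φ => ?_
  show heisenbergOp U u z (heisenbergOp U v w φ) = _
  simp only [heisenbergOp_apply, map_smul, LinearIsometryEquiv.apply_symm_apply,
    shift_shift, smul_smul, Circle.coe_mul]
  congr 1
  ring

theorem heisenbergOp_one (U : ℋ ≃ₗᵢ[ℂ] Lp ℂ 2 μ) :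
    heisenbergOp U 1 (1 : PhaseSpace A) = 1 := by
  refine LinearIsometryEquiv.ext fun φ => ?_
  simp [heisenbergOp_apply, shift_one]

/-- The Heisenberg group `{u W(z) : u ∈ U(1), z ∈ A × Â}`, with composition as group law. -/
def heisenbergGroup (U : ℋ ≃ₗᵢ[ℂ] Lp ℂ 2 μ) : Subgroup (ℋ ≃ₗᵢ[ℂ] ℋ) where
  carrier := {T | ∃ (u : Circle) (z : PhaseSpace A), heisenbergOp U u z = T}
  mul_mem' := by
    rintro _ _ ⟨u, z, rfl⟩ ⟨v, w, rfl⟩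
    exact ⟨_, _, (heisenbergOp_mul U u v z w).symm⟩
  one_mem' := ⟨1, 1, heisenbergOp_one U⟩
  inv_mem' := by
    rintro _ ⟨u, z, rfl⟩
    refine ⟨u⁻¹ * (z.2 z.1)⁻¹, z⁻¹, ?_⟩
    rw [eq_inv_iff_mul_eq_one, heisenbergOp_mul, ← heisenbergOp_one U]
    simp

/-- `u W(z)` as an element of the Heisenberg group. -/
def heisenbergElt (U : ℋ ≃ₗᵢ[ℂ] Lp ℂ 2 μ) (u : Circle) (z : PhaseSpace A) :
    heisenbergGroup U :=
  ⟨heisenbergOp U u z, u, z, rfl⟩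

theorem heisenbergElt_mul (U : ℋ ≃ₗᵢ[ℂ] Lp ℂ 2 μ) (u v : Circle) (z w : PhaseSpace A) :
    heisenbergElt U u z * heisenbergElt U v w =
      heisenbergElt U (u * v * (w.2 z.1)⁻¹) (z * w) :=
  Subtype.ext (heisenbergOp_mul U u v z w)

variable [LocallyCompactSpace A] [T2Space A]

theorem shift_injective {u v : Circle} {z w : PhaseSpace A}
    (h : ∀ ψ : Lp ℂ 2 μ, (u : ℂ) • shift z ψ = (v : ℂ) • shift w ψ) : u = v ∧ z = w := by
  have key : ∀ V : Set A, IsOpen V → μ V ≠ ∞ →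
      ∀ᵐ y ∂μ, (u : ℂ) * ((z.2 y : ℂ) * V.indicator (fun _ => 1) (y / z.1)) =
        (v : ℂ) * ((w.2 y : ℂ) * V.indicator (fun _ => 1) (y / w.1)) := by
    intro V hV hVf
    have h0 := h (indicatorConstLp 2 hV.measurableSet hVf (1 : ℂ))
    have hi := indicatorConstLp_coeFn (p := 2) (hs := hV.measurableSet) (hμs := hVf) (c := (1 : ℂ))
    set ψ := indicatorConstLp 2 hV.measurableSet hVf (1 : ℂ)
    have h1 : ((u : ℂ) • shift z ψ : Lp ℂ 2 μ) =ᵐ[μ] ((v : ℂ) • shift w ψ : Lp ℂ 2 μ) := by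
      rw [h0]
    filter_upwards [h1, Lp.coeFn_smul (u : ℂ) (shift z ψ), Lp.coeFn_smul (v : ℂ) (shift w ψ),
      coeFn_shift z ψ, coeFn_shift w ψ, ae_div hi z.1, ae_div hi w.1] with y g1 g2 g3 g4 g5 g6 g7
    rw [g2, g3, Pi.smul_apply, Pi.smul_apply, g4, g5, g6, g7] at g1
    exact g1
  have nhd : ∀ a : A, ∃ V : Set A, IsOpen V ∧ a ∈ V ∧ μ V ≠ ∞ := fun a => by
    obtain ⟨V, h1, h2, h3⟩ := μ.exists_isOpen_measure_lt_top a
    exact ⟨V, h2, h1, h3.ne⟩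
  have hx : z.1 = w.1 := by
    by_contra hne
    obtain ⟨P, Q, hP, hQ, hzP, hwQ, hPQ⟩ := t2_separation hne
    obtain ⟨V, hV, h1V, hVf⟩ := nhd 1
    let V' : Set A := V ∩ ((fun a => a * z.1) ⁻¹' P ∩ (fun a => a * w.1) ⁻¹' Q)
    have hV' : IsOpen V' := hV.inter
      ((hP.preimage (by fun_prop)).inter (hQ.preimage (by fun_prop)))
    have hf : μ V' ≠ ∞ := ((measure_mono Set.inter_subset_left).trans_lt hVf.lt_top).ne
    let O : Set A := (fun y => y / z.1) ⁻¹' V'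
    have hO : IsOpen O := hV'.preimage (by fun_prop)
    have hOne : O.Nonempty := ⟨z.1, by simp [O, V', h1V, hzP, hwQ]⟩
    refine (hO.measure_pos μ hOne).ne' ?_
    refine measure_mono_null ?_ (ae_iff.1 (key V' hV' hf))
    intro y hy
    have hy' : y / w.1 ∉ V' := by
      intro hc
      have e1 : y ∈ P := by simpa using hy.2.1
      have e2 : y ∈ Q := by simpa using hc.2.2
      exact Set.disjoint_left.1 hPQ e1 e2
    have hy1 : y / z.1 ∈ V' := hy
    simp [Set.indicator_of_mem hy1, Set.indicator_of_notMem hy']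
  have hall : ∀ a : A, u * z.2 a = v * w.2 a := by
    intro a
    by_contra hne
    obtain ⟨V, hV, haV, hVf⟩ := nhd (a / z.1)
    let O : Set A := (fun y => y / z.1) ⁻¹' V ∩ {y | u * z.2 y ≠ v * w.2 y}
    have hO : IsOpen O := (hV.preimage (by fun_prop)).inter
      (isOpen_ne_fun (continuous_const.mul (map_continuous z.2))
        (continuous_const.mul (map_continuous w.2)))
    refine (hO.measure_pos μ ⟨a, haV, hne⟩).ne' ?_
    refine measure_mono_null ?_ (ae_iff.1 (key V hV hVf))
    intro y hy
    have hy1 : y / z.1 ∈ V := hy.1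
    intro hc
    apply hy.2
    rw [← hx, Set.indicator_of_mem hy1, mul_one, mul_one] at hc
    ext
    simpa using hc
  have huv : u = v := by simpa using hall 1
  refine ⟨huv, Prod.ext hx (PontryaginDual.ext fun a => ?_)⟩
  have := hall a
  rwa [huv, mul_right_inj] at this

theorem heisenbergElt_injective (U : ℋ ≃ₗᵢ[ℂ] Lp ℂ 2 μ) {u v : Circle} {z w : PhaseSpace A}
    (h : heisenbergElt U u z = heisenbergElt U v w) : u = v ∧ z = w := by
  refine shift_injective (μ := μ) fun ψ => ?_
  have h1 : heisenbergOp U u z (U.symm ψ) = heisenbergOp U v w (U.symm ψ) := by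
    have h0 : heisenbergOp U u z = heisenbergOp U v w := congrArg Subtype.val h
    rw [h0]
  have h2 := congrArg U h1
  simpa [heisenbergOp_apply] using h2

/-- The natural bijection `U(1) × (A × Â) ≃ ℍ_A`, `(u, z) ↦ u W(z)`. -/
def heisenbergEquiv (U : ℋ ≃ₗᵢ[ℂ] Lp ℂ 2 μ) : Circle × PhaseSpace A ≃ heisenbergGroup U :=
  Equiv.ofBijective (fun p => heisenbergElt U p.1 p.2)
    ⟨fun p q h => by
      obtain ⟨h1, h2⟩ := heisenbergElt_injective U h
      exact Prod.ext h1 h2,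
     fun g => by
      obtain ⟨T, u, z, rfl⟩ := g
      exact ⟨(u, z), rfl⟩⟩

/-- The Heisenberg group carries the topology of `U(1) × A × Â`. -/
instance heisenbergTopology (U : ℋ ≃ₗᵢ[ℂ] Lp ℂ 2 μ) : TopologicalSpace (heisenbergGroup U) :=
  TopologicalSpace.induced (heisenbergEquiv U).symm inferInstance

theorem heisenbergEquiv_symm_elt (U : ℋ ≃ₗᵢ[ℂ] Lp ℂ 2 μ) (u : Circle) (z : PhaseSpace A) :
    (heisenbergEquiv U).symm (heisenbergElt U u z) = (u, z) :=
  (heisenbergEquiv U).symm_apply_apply (u, z)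

/-- The homomorphism `ℍ_A → A × Â`, `u W(z) ↦ z`. -/
def heisenbergProj (U : ℋ ≃ₗᵢ[ℂ] Lp ℂ 2 μ) : heisenbergGroup U →* PhaseSpace A :=
  MonoidHom.mk' (fun g => ((heisenbergEquiv U).symm g).2) (by
    rintro ⟨_, u, z, rfl⟩ ⟨_, v, w, rfl⟩
    have h := heisenbergElt_mul U u v z w
    show ((heisenbergEquiv U).symm (heisenbergElt U u z * heisenbergElt U v w)).2 =
      ((heisenbergEquiv U).symm (heisenbergElt U u z)).2 *
        ((heisenbergEquiv U).symm (heisenbergElt U v w)).2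
    rw [h, heisenbergEquiv_symm_elt, heisenbergEquiv_symm_elt, heisenbergEquiv_symm_elt])

@[simp]
theorem heisenbergProj_elt (U : ℋ ≃ₗᵢ[ℂ] Lp ℂ 2 μ) (u : Circle) (z : PhaseSpace A) :
    heisenbergProj U (heisenbergElt U u z) = z :=
  congrArg Prod.snd (heisenbergEquiv_symm_elt U u z)

/-- The class `𝔊`: the (underlying sets of) compact subgroups of the Heisenberg group on which
`u W(z) ↦ z` is injective, with an image of measure `1` in `A × Â`. -/
def stabilizerClass [MeasurableSpace (PontryaginDual A)] [BorelSpace (PontryaginDual A)]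
    (ν : Measure (PontryaginDual A)) [ν.IsHaarMeasure]
    (U : ℋ ≃ₗᵢ[ℂ] Lp ℂ 2 μ) : Set (Set (heisenbergGroup U)) :=
  {𝒢 | ∃ G : Subgroup (heisenbergGroup U), (G : Set (heisenbergGroup U)) = 𝒢 ∧
    IsCompact 𝒢 ∧ Set.InjOn (heisenbergProj U) 𝒢 ∧
    radonProduct μ ν (heisenbergProj U '' 𝒢) = 1}

/-- The Pauli group `{ζ ^ k W(z) : k ∈ ℤ, z ∈ A × Â}` with `ζ = exp (π i / N)`, for a finite group
`A` of cardinality `N`. -/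
def pauliGroup (U : ℋ ≃ₗᵢ[ℂ] Lp ℂ 2 μ) : Set (heisenbergGroup U) :=
  {g | ∃ (k : ℤ) (z : PhaseSpace A),
    g = heisenbergElt U (Circle.exp (Real.pi / Nat.card A) ^ k) z}

end Operators

end WeylHeisenberg

end

open WeylHeisenberg

/-! The argument separates an algebraic part from a measure computation. Algebra: the product of `u
W(z)` and `v W(w)` has phase `u v β'(z)(w)`, so `z ↦ α(z) W(z)` is multiplicative on an isotropic
`K` exactly when `α` is of second degree for `β'`. Conversely, if `z` determines `u W(z)` within a
subgroup `𝒢`, then `𝒢` is commutative, because `A × Â` is; its image is therefore isotropic, and `α`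
is the phase of the inverse of the projection (`exists_isSecondDegreeCharacter`). Measure: let `K`
be compact open isotropic, `P` its projection to `A` and `F` its fibre over `1`. All nonempty fibres
are cosets of `F`, so `K` has measure `μ(P) ν(F)`. Isotropy gives `F ≤ P^⊥`, with equality if `K` is
maximal, and Fourier inversion for the indicator of `P` gives `μ(P) ν(P^⊥) = 1`. So compact open
isotropic subgroups have measure at most `1`, and maximal ones exactly `1`. Conversely, a compact
isotropic subgroup of measure `1` is open by Steinhaus' theorem, and a strictly larger compact open
isotropic subgroup would have measure greater than `1`. For finite `A`, evaluating the second-degree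
law on powers of `z` shows that `α(z)` is a root of unity of order dividing `2N`. -/

noncomputable section

namespace WeylHeisenberg

/-! ### The annihilator of a compact open subgroup -/

section Annihilator

variable {A : Type*} [CommGroup A] [TopologicalSpace A]

/-- The characters of `A` that are trivial on `B`. -/
def annihilator (B : Subgroup A) : Subgroup (PontryaginDual A) where
  carrier := {ξ | ∀ b ∈ B, ξ b = 1}
  one_mem' := fun _ _ => rfl
  mul_mem' := fun {ξ η} hξ hη b hb => by
    show ξ b * η b = 1
    rw [hξ b hb, hη b hb, one_mul]
  inv_mem' := fun {ξ} hξ b hb => by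
    show (ξ b)⁻¹ = 1
    rw [hξ b hb, inv_one]

theorem mem_annihilator {B : Subgroup A} {ξ : PontryaginDual A} :
    ξ ∈ annihilator B ↔ ∀ b ∈ B, ξ b = 1 :=
  Iff.rfl

/-- The annihilator is the kernel of the restriction `Â → B̂`, and the dual of a compact group is
discrete. -/
theorem isOpen_annihilator {B : Subgroup A} (hB : IsCompact (B : Set A)) :
    IsOpen (annihilator B : Set (PontryaginDual A)) := by
  have : CompactSpace B := isCompact_iff_compactSpace.1 hB
  let ι : B →ₜ* A := ⟨B.subtype, continuous_subtype_val⟩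
  have h : (annihilator B : Set (PontryaginDual A)) = PontryaginDual.map ι ⁻¹' {1} := by
    ext ξ
    simp only [SetLike.mem_coe, mem_annihilator, Set.mem_preimage, Set.mem_singleton_iff]
    constructor
    · intro hξ
      exact PontryaginDual.ext fun b => hξ b b.2
    · intro hξ b hb
      exact DFunLike.congr_fun hξ ⟨b, hb⟩
  rw [h]
  exact (isOpen_discrete _).preimage (map_continuous _)

/-- The annihilator is the image of the dual of `A ⧸ B`, which is compact because `A ⧸ B` is
discrete. -/
theorem isCompact_annihilator [IsTopologicalGroup A] {B : Subgroup A} (hB : IsOpen (B : Set A)) :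
    IsCompact (annihilator B : Set (PontryaginDual A)) := by
  have : DiscreteTopology (A ⧸ B) := QuotientGroup.discreteTopology hB
  let q : A →ₜ* (A ⧸ B) := ⟨QuotientGroup.mk' B, continuous_quotient_mk'⟩
  have h : (annihilator B : Set (PontryaginDual A)) = Set.range (PontryaginDual.map q) := by
    ext ξ
    simp only [SetLike.mem_coe, mem_annihilator, Set.mem_range]
    constructor
    · intro hξ
      let η : (A ⧸ B) →ₜ* Circle :=
        ⟨QuotientGroup.lift B (MonoidHomClass.toMonoidHom ξ) hξ, continuous_of_discreteTopology⟩
      exact ⟨η, PontryaginDual.ext fun a => rfl⟩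
    · rintro ⟨η, rfl⟩ b hb
      have hb' : q b = 1 := (QuotientGroup.eq_one_iff b).2 hb
      rw [PontryaginDual.map_apply, hb', map_one]
  rw [h]
  exact isCompact_range (map_continuous _)

variable [IsTopologicalGroup A] [MeasurableSpace A] [BorelSpace A]
  (μ : Measure A) [μ.IsHaarMeasure]

theorem fourierTransform_indicator {B : Subgroup A} (hB : IsOpen (B : Set A))
    (ξ : PontryaginDual A) :
    fourierTransform μ ((B : Set A).indicator fun _ => 1) ξ =
      (annihilator B : Set (PontryaginDual A)).indicator (fun _ => (μ.real B : ℂ)) ξ := by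
  unfold fourierTransform
  by_cases hξ : ξ ∈ annihilator B
  · rw [Set.indicator_of_mem hξ]
    have : (fun x => starRingEnd ℂ (ξ x : ℂ) * (B : Set A).indicator (fun _ => (1 : ℂ)) x) =
        (B : Set A).indicator fun _ => (1 : ℂ) := by
      funext x
      by_cases hx : x ∈ (B : Set A)
      · simp [hx, hξ x hx]
      · simp [hx]
    rw [this, integral_indicator hB.measurableSet]
    simp
  · rw [Set.indicator_of_notMem hξ]
    obtain ⟨b, hb, hξb⟩ : ∃ b ∈ B, ξ b ≠ 1 := by
      simpa [mem_annihilator] using hξ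
    -- Translation by `b` preserves the integral but multiplies it by `conj (ξ b) ≠ 1`, so the
    -- integral vanishes.
    have h := integral_mul_left_eq_self (μ := μ)
      (fun x => starRingEnd ℂ (ξ x : ℂ) * (B : Set A).indicator (fun _ => (1 : ℂ)) x) b
    have e : ∀ x, starRingEnd ℂ (ξ (b * x) : ℂ) *
        (B : Set A).indicator (fun _ => (1 : ℂ)) (b * x) = starRingEnd ℂ (ξ b : ℂ) *
        (starRingEnd ℂ (ξ x : ℂ) * (B : Set A).indicator (fun _ => (1 : ℂ)) x) := by
      intro x
      have hx : b * x ∈ (B : Set A) ↔ x ∈ (B : Set A) := B.mul_mem_cancel_left hb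
      rw [map_mul, Circle.coe_mul, map_mul, mul_assoc]
      by_cases h : x ∈ (B : Set A)
      · rw [Set.indicator_of_mem h, Set.indicator_of_mem (hx.2 h)]
      · rw [Set.indicator_of_notMem h, Set.indicator_of_notMem (fun h' => h (hx.1 h'))]
    simp_rw [e] at h
    rw [integral_const_mul] at h
    by_contra hne
    have h1 : starRingEnd ℂ (ξ b : ℂ) = 1 := mul_right_cancel₀ hne (h.trans (one_mul _).symm)
    refine hξb (Circle.ext ?_)
    have h2 := congrArg (starRingEnd ℂ) h1
    simpa using h2

theorem continuous_indicator_subgroup {B : Subgroup A} (hB : IsOpen (B : Set A)) :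
    Continuous ((B : Set A).indicator fun _ => (1 : ℂ)) :=
  (continuous_const (y := (1 : ℂ))).indicator (by
    have : IsClopen (B : Set A) := ⟨B.isClosed_of_isOpen hB, hB⟩
    simp [this.frontier_eq])

/-- This is Fourier inversion for the indicator of `B`, evaluated at the identity. It is the only
use of the normalization of `ν`. -/
theorem measureReal_mul_measureReal_annihilator [MeasurableSpace (PontryaginDual A)]
    [BorelSpace (PontryaginDual A)] {ν : Measure (PontryaginDual A)}
    [IsFiniteMeasureOnCompacts ν] (hν : FourierInversion μ ν)
    {B : Subgroup A} (hBo : IsOpen (B : Set A)) (hBc : IsCompact (B : Set A)) :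
    μ.real B * ν.real (annihilator B : Set (PontryaginDual A)) = 1 := by
  have hF : fourierTransform μ ((B : Set A).indicator fun _ => 1) =
      (annihilator B : Set (PontryaginDual A)).indicator fun _ => (μ.real B : ℂ) :=
    funext (fourierTransform_indicator μ hBo)
  have hm : MeasurableSet (annihilator B : Set (PontryaginDual A)) :=
    (isOpen_annihilator hBc).measurableSet
  have h := hν _ (continuous_indicator_subgroup hBo)
    ((integrable_indicator_iff hBo.measurableSet).2
      (integrableOn_const hBc.measure_lt_top.ne))
    (by
      rw [hF]
      exact (integrable_indicator_iff hm).2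
        (integrableOn_const (isCompact_annihilator hBo).measure_lt_top.ne)) 1
  rw [hF, Set.indicator_of_mem B.one_mem] at h
  simp only [map_one, Circle.coe_one, one_mul] at h
  rw [integral_indicator hm, setIntegral_const, Complex.real_smul, ← Complex.ofReal_mul] at h
  rw [mul_comm]
  exact_mod_cast h.symm

end Annihilator

/-! ### The Radon product of two Haar measures -/

section RadonProduct

section

variable {X Y : Type*} [TopologicalSpace X] [TopologicalSpace Y]
  [MeasurableSpace X] [MeasurableSpace Y] [BorelSpace X] [BorelSpace Y]
  [T2Space X] [T2Space Y] (μ : Measure X) (ν : Measure Y)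
  [IsFiniteMeasureOnCompacts μ] [IsFiniteMeasureOnCompacts ν]
  [LocallyCompactSpace X] [LocallyCompactSpace Y]

theorem radonProduct_ne_top {K : Set (X × Y)} (hK : IsCompact K) : radonProduct μ ν K ≠ ∞ := by
  let : MeasurableSpace (X × Y) := borel (X × Y)
  have : BorelSpace (X × Y) := ⟨rfl⟩
  have : (radonProduct μ ν).Regular := RealRMK.regular_rieszMeasure _
  exact hK.measure_lt_top.ne

/-- The indicator of a compact open set is itself in `C_c`, so the defining property of the Radon
product applies to it directly. -/
theorem toReal_radonProduct {K : Set (X × Y)} (hc : IsCompact K) (ho : IsOpen K) :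
    (radonProduct μ ν K).toReal = ∫ x, ν.real (Prod.mk x ⁻¹' K) ∂μ := by
  let : MeasurableSpace (X × Y) := borel (X × Y)
  have : BorelSpace (X × Y) := ⟨rfl⟩
  have hcl : IsClopen K := ⟨hc.isClosed, ho⟩
  let f : C_c(X × Y, ℝ) :=
    { toFun := K.indicator fun _ => 1
      continuous_toFun := (continuous_const (y := (1 : ℝ))).indicator (by simp [hcl.frontier_eq])
      hasCompactSupport' := HasCompactSupport.of_support_subset_isCompact hc
        Set.support_indicator_subset }
  have h : ∫ p, f p ∂(radonProduct μ ν) = ∫ x, ∫ y, f (x, y) ∂ν ∂μ :=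
    RealRMK.integral_rieszMeasure (iteratedIntegral μ ν) f
  have h1 : ∫ p, f p ∂(radonProduct μ ν) = (radonProduct μ ν K).toReal :=
    integral_indicator_one ho.measurableSet
  rw [← h1, h]
  congr 1
  funext x
  exact integral_indicator_one (ho.preimage (by fun_prop : Continuous (Prod.mk x))).measurableSet

end

variable {X Y : Type*} [Group X] [Group Y] [TopologicalSpace X] [TopologicalSpace Y]
  [IsTopologicalGroup X] [IsTopologicalGroup Y]
  [MeasurableSpace X] [MeasurableSpace Y] [BorelSpace X] [BorelSpace Y]
  [T2Space X] [T2Space Y] (μ : Measure X) (ν : Measure Y)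
  [μ.IsHaarMeasure] [ν.IsHaarMeasure]
  [LocallyCompactSpace X] [LocallyCompactSpace Y]

/-- The iterated integral is invariant under translations, and a regular measure is determined by
its integrals on `C_c`. -/
theorem isHaarMeasure_radonProduct (h0 : radonProduct μ ν ≠ 0) :
    @Measure.IsHaarMeasure (X × Y) _ _ (borel (X × Y)) (radonProduct μ ν) := by
  let : MeasurableSpace (X × Y) := borel (X × Y)
  have : BorelSpace (X × Y) := ⟨rfl⟩
  have : (radonProduct μ ν).Regular := RealRMK.regular_rieszMeasure _
  have : NeZero (radonProduct μ ν) := ⟨h0⟩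
  have : (radonProduct μ ν).IsMulLeftInvariant := by
    refine ⟨fun z => ?_⟩
    have : ((radonProduct μ ν).map (z * ·)).Regular :=
      Measure.Regular.map (Homeomorph.mulLeft z)
    refine Measure.ext_of_integral_eq_on_compactlySupported fun f => ?_
    rw [integral_map (by fun_prop) (by fun_prop)]
    have e (p : X × Y) : f (z * p) = f.comp (Homeomorph.mulLeft z).toCocompactMap p := rfl
    simp_rw [e]
    unfold radonProduct
    rw [RealRMK.integral_rieszMeasure, RealRMK.integral_rieszMeasure]
    show ∫ x, ∫ y, f (z.1 * x, z.2 * y) ∂ν ∂μ = ∫ x, ∫ y, f (x, y) ∂ν ∂μ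
    have e1 (x : X) : ∫ y, f (z.1 * x, z.2 * y) ∂ν = ∫ y, f (z.1 * x, y) ∂ν :=
      integral_mul_left_eq_self (fun y => f (z.1 * x, y)) z.2
    simp_rw [e1]
    exact integral_mul_left_eq_self (fun x => ∫ y, f (x, y) ∂ν) z.1
  -- Finiteness on compact sets comes from regularity; positivity on open sets comes from
  -- regularity, invariance and `h0`.
  exact { }

/-- By Steinhaus' theorem, `K / K` is a neighbourhood of `1`, and it lies in `K`. -/
theorem isOpen_of_radonProduct_ne_zero {K : Subgroup (X × Y)} (hc : IsCompact (K : Set (X × Y)))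
    (h0 : radonProduct μ ν K ≠ 0) : IsOpen (K : Set (X × Y)) := by
  let : MeasurableSpace (X × Y) := borel (X × Y)
  have : BorelSpace (X × Y) := ⟨rfl⟩
  have : (radonProduct μ ν).Regular := RealRMK.regular_rieszMeasure _
  have : (radonProduct μ ν).IsHaarMeasure :=
    isHaarMeasure_radonProduct μ ν fun h => h0 (by rw [h]; rfl)
  have h := Measure.div_mem_nhds_one_of_haar_pos_ne_top (radonProduct μ ν) (K : Set (X × Y))
    hc.measurableSet (pos_iff_ne_zero.2 h0) hc.measure_lt_top.ne
  refine K.isOpen_of_mem_nhds (g := 1) (Filter.mem_of_superset h ?_)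
  rintro _ ⟨a, ha, b, hb, rfl⟩
  exact K.div_mem ha hb

/-- The set `L \ K` is open, so it has positive Haar measure unless it is empty. -/
theorem eq_of_le_of_radonProduct_le {K L : Subgroup (X × Y)} (hKL : K ≤ L)
    (hKc : IsCompact (K : Set (X × Y))) (hLo : IsOpen (L : Set (X × Y)))
    (h0 : radonProduct μ ν K ≠ 0)
    (h : radonProduct μ ν L ≤ radonProduct μ ν K) : L ≤ K := by
  let : MeasurableSpace (X × Y) := borel (X × Y)
  have : BorelSpace (X × Y) := ⟨rfl⟩
  have : (radonProduct μ ν).IsHaarMeasure :=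
    isHaarMeasure_radonProduct μ ν fun h => h0 (by rw [h]; rfl)
  by_contra hLK
  obtain ⟨z, hz, hzK⟩ := SetLike.not_le_iff_exists.1 hLK
  have hpos : 0 < radonProduct μ ν ((L : Set (X × Y)) \ K) :=
    (hLo.sdiff hKc.isClosed).measure_pos _ ⟨z, hz, hzK⟩
  have hd := measure_sdiff (μ := radonProduct μ ν) (show (K : Set (X × Y)) ⊆ L from hKL)
    hKc.measurableSet.nullMeasurableSet hKc.measure_lt_top.ne
  rw [hd, tsub_eq_zero_of_le h] at hpos
  exact hpos.false

/-- The fibre over the identity of a subgroup of a product. -/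
def fiberSubgroup (K : Subgroup (X × Y)) : Subgroup Y := K.comap (MonoidHom.inr X Y)

theorem toReal_radonProduct_subgroup {K : Subgroup (X × Y)} (hc : IsCompact (K : Set (X × Y)))
    (ho : IsOpen (K : Set (X × Y))) :
    (radonProduct μ ν K).toReal =
      μ.real (K.map (MonoidHom.fst X Y)) * ν.real (fiberSubgroup K : Set Y) := by
  rw [toReal_radonProduct μ ν hc ho]
  have hP : IsOpen (K.map (MonoidHom.fst X Y) : Set X) := isOpenMap_fst _ ho
  have e : (fun x => ν.real (Prod.mk x ⁻¹' (K : Set (X × Y)))) =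
      (K.map (MonoidHom.fst X Y) : Set X).indicator
        fun _ => ν.real (fiberSubgroup K : Set Y) := by
    funext x
    by_cases hx : x ∈ K.map (MonoidHom.fst X Y)
    · rw [Set.indicator_of_mem hx]
      obtain ⟨⟨x, y⟩, hxy, rfl⟩ := hx
      rw [Measure.real, Measure.real]
      congr 1
      -- The fibre over `x` is the coset `y F` of the fibre `F` over `1`.
      rw [← measure_preimage_mul ν y]
      congr 1
      ext t
      show (x, y * t) ∈ K ↔ (1, t) ∈ K
      rw [← K.mul_mem_cancel_left hxy (y := ((1 : X), t))]
      simp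
    · rw [Set.indicator_of_notMem hx]
      have : Prod.mk x ⁻¹' (K : Set (X × Y)) = ∅ := by
        ext y
        simp only [Set.mem_preimage, Set.mem_empty_iff_false, iff_false]
        exact fun h => hx ⟨(x, y), h, rfl⟩
      simp [this]
  rw [e, integral_indicator hP.measurableSet, setIntegral_const, smul_eq_mul]

end RadonProduct

/-! ### The measure of a compact open isotropic subgroup -/

section IsotropicMeasure

variable {A : Type*} [CommGroup A] [TopologicalSpace A] [IsTopologicalGroup A]

theorem fiberSubgroup_le_annihilator {K : Subgroup (PhaseSpace A)} (hK : IsIsotropic K) :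
    fiberSubgroup K ≤ annihilator (K.map (MonoidHom.fst A (PontryaginDual A))) := by
  rintro η hη _ ⟨z, hz, rfl⟩
  have h := symplecticForm_eq_one_iff.1 (hK z hz (1, η) hη)
  simpa using h.symm

/-- Adjoining `{1} × P^⊥` to `K`, where `P` is the projection of `K`, keeps it compact, open and
isotropic; by maximality nothing new is added. -/
theorem IsMaximalCompactOpenIsotropic.fiberSubgroup_eq [LocallyCompactSpace A]
    {K : Subgroup (PhaseSpace A)} (hK : IsMaximalCompactOpenIsotropic K) :
    fiberSubgroup K = annihilator (K.map (MonoidHom.fst A (PontryaginDual A))) := by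
  refine le_antisymm (fiberSubgroup_le_annihilator hK.isIsotropic) ?_
  set P := K.map (MonoidHom.fst A (PontryaginDual A))
  have hPo : IsOpen (P : Set A) := isOpenMap_fst _ hK.prop.isOpen
  let N : Subgroup (PhaseSpace A) := (annihilator P).map (MonoidHom.inr A (PontryaginDual A))
  have hN : IsCompact (N : Set (PhaseSpace A)) :=
    (isCompact_annihilator hPo).image (by
      show Continuous fun ξ : PontryaginDual A => ((1 : A), ξ)
      fun_prop)
  have hKN : IsCompactOpenIsotropic (K ⊔ N) := by
    refine ⟨?_, Subgroup.isOpen_mono le_sup_left hK.prop.isOpen, ?_⟩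
    · rw [Subgroup.mul_normal]
      exact hK.prop.isCompact.mul hN
    · intro z hz w hw
      obtain ⟨z, hzK, _, ⟨ξ, hξ, rfl⟩, rfl⟩ := Subgroup.mem_sup.1 hz
      obtain ⟨w, hwK, _, ⟨η, hη, rfl⟩, rfl⟩ := Subgroup.mem_sup.1 hw
      rw [symplecticForm_eq_one_iff]
      have h1 : ξ w.1 = 1 := hξ _ ⟨w, hwK, rfl⟩
      have h2 : η z.1 = 1 := hη _ ⟨z, hzK, rfl⟩
      show z.2 (w.1 * 1) * ξ (w.1 * 1) = w.2 (z.1 * 1) * η (z.1 * 1)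
      rw [mul_one, mul_one, h1, h2, symplecticForm_eq_one_iff.1 (hK.isIsotropic z hzK w hwK)]
  intro ξ hξ
  exact hK.2 hKN le_sup_left (Subgroup.mem_sup_right ⟨ξ, hξ, rfl⟩)

variable [LocallyCompactSpace A] [T2Space A] [MeasurableSpace A] [BorelSpace A]
  {μ : Measure A} [μ.IsHaarMeasure]
  [MeasurableSpace (PontryaginDual A)] [BorelSpace (PontryaginDual A)]
  {ν : Measure (PontryaginDual A)} [ν.IsHaarMeasure]

theorem measureReal_map_fst_mul_annihilator (hν : FourierInversion μ ν)
    {K : Subgroup (PhaseSpace A)} (hK : IsCompactOpenIsotropic K) :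
    μ.real (K.map (MonoidHom.fst A (PontryaginDual A))) *
      ν.real (annihilator (K.map (MonoidHom.fst A (PontryaginDual A))) :
        Set (PontryaginDual A)) = 1 :=
  measureReal_mul_measureReal_annihilator μ hν (isOpenMap_fst _ hK.isOpen)
    (hK.isCompact.image continuous_fst)

theorem IsCompactOpenIsotropic.radonProduct_le_one (hν : FourierInversion μ ν)
    {K : Subgroup (PhaseSpace A)} (hK : IsCompactOpenIsotropic K) :
    radonProduct μ ν K ≤ 1 := by
  have hPo : IsOpen (K.map (MonoidHom.fst A (PontryaginDual A)) : Set A) :=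
    isOpenMap_fst _ hK.isOpen
  rw [← ENNReal.toReal_le_toReal (radonProduct_ne_top μ ν hK.isCompact) ENNReal.one_ne_top,
    ENNReal.toReal_one, toReal_radonProduct_subgroup μ ν hK.isCompact hK.isOpen,
    ← measureReal_map_fst_mul_annihilator hν hK]
  exact mul_le_mul_of_nonneg_left
    (measureReal_mono (fiberSubgroup_le_annihilator hK.isIsotropic)
      (isCompact_annihilator hPo).measure_lt_top.ne) measureReal_nonneg

theorem IsMaximalCompactOpenIsotropic.radonProduct_eq_one (hν : FourierInversion μ ν)
    {K : Subgroup (PhaseSpace A)} (hK : IsMaximalCompactOpenIsotropic K) :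
    radonProduct μ ν K = 1 := by
  rw [← ENNReal.toReal_eq_one_iff, toReal_radonProduct_subgroup μ ν hK.prop.isCompact
    hK.prop.isOpen, hK.fiberSubgroup_eq, measureReal_map_fst_mul_annihilator hν hK.prop]

theorem isMaximalCompactOpenIsotropic_of_radonProduct_eq_one (hν : FourierInversion μ ν)
    {K : Subgroup (PhaseSpace A)} (hc : IsCompact (K : Set (PhaseSpace A)))
    (hi : IsIsotropic K) (h1 : radonProduct μ ν K = 1) : IsMaximalCompactOpenIsotropic K := by
  have h0 : radonProduct μ ν K ≠ 0 := by simp [h1]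
  refine ⟨⟨hc, isOpen_of_radonProduct_ne_zero μ ν hc h0, hi⟩, fun L hL hKL => ?_⟩
  exact eq_of_le_of_radonProduct_le μ ν hKL hc hL.isOpen h0
    (h1 ▸ hL.radonProduct_le_one hν)

end IsotropicMeasure

/-! ### Sections of the Heisenberg group over isotropic subgroups -/

section Heisenberg

variable {A : Type*} [CommGroup A] [TopologicalSpace A] [IsTopologicalGroup A]
  [MeasurableSpace A] [BorelSpace A] {μ : Measure A} [μ.IsHaarMeasure]
  {ℋ : Type*} [NormedAddCommGroup ℋ] [InnerProductSpace ℂ ℋ]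
  [LocallyCompactSpace A] [T2Space A] (U : ℋ ≃ₗᵢ[ℂ] Lp ℂ 2 μ)

/-- The bijection `(u, z) ↦ u W(z)` as a homeomorphism. -/
def heisenbergHomeomorph : Circle × PhaseSpace A ≃ₜ heisenbergGroup U where
  toEquiv := heisenbergEquiv U
  continuous_toFun := continuous_induced_rng.2 (by
    have : (heisenbergEquiv U).symm ∘ (heisenbergEquiv U).toFun = id :=
      funext (heisenbergEquiv U).symm_apply_apply
    rw [this]
    exact continuous_id)
  continuous_invFun := continuous_induced_dom

/-- The phase `u` of the operator `u W(z)`. -/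
def heisenbergPhase (g : heisenbergGroup U) : Circle := ((heisenbergHomeomorph U).symm g).1

theorem continuous_heisenbergPhase : Continuous (heisenbergPhase U) :=
  continuous_fst.comp (heisenbergHomeomorph U).symm.continuous

theorem continuous_heisenbergProj : Continuous (heisenbergProj U) :=
  continuous_snd.comp (heisenbergHomeomorph U).symm.continuous

theorem continuous_heisenbergElt :
    Continuous fun p : Circle × PhaseSpace A => heisenbergElt U p.1 p.2 :=
  (heisenbergHomeomorph U).continuous

@[simp]
theorem heisenbergPhase_elt (u : Circle) (z : PhaseSpace A) :
    heisenbergPhase U (heisenbergElt U u z) = u :=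
  congrArg Prod.fst (heisenbergEquiv_symm_elt U u z)

theorem heisenbergElt_phase_proj (g : heisenbergGroup U) :
    heisenbergElt U (heisenbergPhase U g) (heisenbergProj U g) = g :=
  (heisenbergEquiv U).apply_symm_apply g

theorem heisenbergPhase_mul (g h : heisenbergGroup U) :
    heisenbergPhase U (g * h) = heisenbergPhase U g * heisenbergPhase U h *
      ((heisenbergProj U h).2 (heisenbergProj U g).1)⁻¹ := by
  conv_lhs => rw [← heisenbergElt_phase_proj U g, ← heisenbergElt_phase_proj U h,
    heisenbergElt_mul, heisenbergPhase_elt]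

theorem isIsotropic_map_heisenbergProj {G : Subgroup (heisenbergGroup U)}
    (hG : Set.InjOn (heisenbergProj U) G) : IsIsotropic (G.map (heisenbergProj U)) := by
  rintro _ ⟨g, hg, rfl⟩ _ ⟨h, hh, rfl⟩
  -- Both products project to the same point, so injectivity forces `g` and `h` to commute.
  -- Comparing the phases of the two products gives isotropy.
  have hc : g * h = h * g := hG (G.mul_mem hg hh) (G.mul_mem hh hg) (by
    rw [map_mul, map_mul, mul_comm])
  have hp := congrArg (heisenbergPhase U) hc
  rw [heisenbergPhase_mul, heisenbergPhase_mul, mul_comm (heisenbergPhase U h), mul_right_inj,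
    inv_inj] at hp
  exact symplecticForm_eq_one_iff.2 hp.symm

theorem exists_isSecondDegreeCharacter {G : Subgroup (heisenbergGroup U)}
    (hGc : IsCompact (G : Set (heisenbergGroup U))) (hG : Set.InjOn (heisenbergProj U) G) :
    ∃ α : G.map (heisenbergProj U) → Circle,
      IsSecondDegreeCharacter α
        (betaPrime (G.map (heisenbergProj U)) (isIsotropic_map_heisenbergProj U hG)) ∧
      (G : Set (heisenbergGroup U)) =
        {g | ∃ z : G.map (heisenbergProj U), g = heisenbergElt U (α z) z} := by
  have hs : ∀ z : G.map (heisenbergProj U), ∃ g ∈ G, heisenbergProj U g = z := fun z => z.2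
  choose s hsG hs using hs
  let α : G.map (heisenbergProj U) → Circle := fun z => heisenbergPhase U (s z)
  let p : G → G.map (heisenbergProj U) := fun g => ⟨heisenbergProj U g, g, g.2, rfl⟩
  have hsp (g : G) : s (p g) = g := hG (hsG _) g.2 (hs _)
  have hp : Continuous p :=
    ((continuous_heisenbergProj U).comp continuous_subtype_val).subtype_mk _
  have hps : Function.Surjective p := fun z => ⟨⟨s z, hsG z⟩, Subtype.ext (hs z)⟩
  have : CompactSpace G := isCompact_iff_compactSpace.1 hGc
  refine ⟨α, ⟨?_, fun z w => ?_⟩, ?_⟩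
  -- The projection of the compact `G` onto its Hausdorff image is a quotient map, so it suffices
  -- that `α ∘ p`, the phase on `G`, is continuous.
  · rw [(hp.isClosedMap.isQuotientMap hp hps).continuous_iff]
    have : α ∘ p = fun g : G => heisenbergPhase U g :=
      funext fun g => congrArg (heisenbergPhase U) (hsp g)
    rw [this]
    exact (continuous_heisenbergPhase U).comp continuous_subtype_val
  · have h : s (z * w) = s z * s w := hG (hsG _) (G.mul_mem (hsG z) (hsG w)) (by
      rw [map_mul, hs, hs, hs]
      rfl)
    show heisenbergPhase U (s (z * w)) = _
    rw [h, heisenbergPhase_mul, hs, hs, betaPrime_apply]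
  · ext g
    constructor
    · intro hg
      refine ⟨p ⟨g, hg⟩, ?_⟩
      show g = heisenbergElt U (heisenbergPhase U (s (p ⟨g, hg⟩))) (heisenbergProj U g)
      rw [hsp, heisenbergElt_phase_proj]
    · rintro ⟨z, rfl⟩
      have h := heisenbergElt_phase_proj U (s z)
      rw [hs] at h
      show heisenbergElt U (heisenbergPhase U (s z)) z ∈ G
      rw [h]
      exact hsG z

/-- The homomorphism `z ↦ α(z) W(z)` defined by a character of second degree `α`. -/
def secondDegreeSection {K : Subgroup (PhaseSpace A)} {hK : IsIsotropic K} {α : K → Circle}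
    (hα : IsSecondDegreeCharacter α (betaPrime K hK)) : K →* heisenbergGroup U :=
  MonoidHom.mk' (fun z => heisenbergElt U (α z) z) fun z w => by
    rw [heisenbergElt_mul, hα.map_mul, betaPrime_apply]
    rfl

variable [MeasurableSpace (PontryaginDual A)] [BorelSpace (PontryaginDual A)]
  {ν : Measure (PontryaginDual A)} [ν.IsHaarMeasure]

theorem mem_stabilizerClass_iff (hν : FourierInversion μ ν) (𝒢 : Set (heisenbergGroup U)) :
    𝒢 ∈ stabilizerClass ν U ↔
      ∃ (K : Subgroup (PhaseSpace A)) (hK : IsMaximalCompactOpenIsotropic K) (α : K → Circle),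
        IsSecondDegreeCharacter α (betaPrime K hK.isIsotropic) ∧
        𝒢 = {g | ∃ z : K, g = heisenbergElt U (α z) z} := by
  constructor
  · rintro ⟨G, rfl, hc, hi, h1⟩
    obtain ⟨α, hα, hG⟩ := exists_isSecondDegreeCharacter U hc hi
    exact ⟨G.map (heisenbergProj U), isMaximalCompactOpenIsotropic_of_radonProduct_eq_one hν
      (hc.image (continuous_heisenbergProj U)) (isIsotropic_map_heisenbergProj U hi) h1,
      α, hα, hG⟩
  · rintro ⟨K, hK, α, hα, rfl⟩
    have hr : ((secondDegreeSection U hα).range : Set (heisenbergGroup U)) =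
        {g | ∃ z : K, g = heisenbergElt U (α z) z} := by
      ext g
      exact exists_congr fun z => eq_comm
    have : CompactSpace K := isCompact_iff_compactSpace.1 hK.prop.isCompact
    refine ⟨(secondDegreeSection U hα).range, hr, ?_, ?_, ?_⟩
    · rw [← hr]
      exact isCompact_range ((continuous_heisenbergElt U).comp
        (hα.continuous.prodMk continuous_subtype_val))
    · rintro _ ⟨z, rfl⟩ _ ⟨w, rfl⟩ h
      rw [heisenbergProj_elt, heisenbergProj_elt] at h
      rw [Subtype.ext h]
    · have : heisenbergProj U '' {g | ∃ z : K, g = heisenbergElt U (α z) z} = K := by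
        ext z
        constructor
        · rintro ⟨_, ⟨w, rfl⟩, rfl⟩
          rw [heisenbergProj_elt]
          exact w.2
        · intro hz
          exact ⟨_, ⟨⟨z, hz⟩, rfl⟩, heisenbergProj_elt U _ _⟩
      rw [this]
      exact hK.radonProduct_eq_one hν

end Heisenberg

/-! ### Finite groups -/

section Finite

theorem pontryaginDual_pow_apply {G : Type*} [Monoid G] [TopologicalSpace G]
    (ξ : PontryaginDual G) (n : ℕ) (x : G) : (ξ ^ n) x = ξ x ^ n := by
  induction n with
  | zero => simp
  | succ n ih =>
    rw [pow_succ, pow_succ, ← ih]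
    rfl

theorem IsSecondDegreeCharacter.map_one {G : Type*} [CommGroup G] [TopologicalSpace G]
    {h : G → Circle} {β : SymHom G} (hh : IsSecondDegreeCharacter h β) : h 1 = 1 := by
  have h1 := hh.map_mul 1 1
  rw [mul_one, _root_.map_one, mul_one] at h1
  exact left_eq_mul.1 h1

/-- The step from `n` to `n + 1` contributes `β(z ^ n)(z) = β(z)(z) ^ n`, and `0 + 1 + ... + (n - 1)
= n.choose 2`. -/
theorem IsSecondDegreeCharacter.map_pow {G : Type*} [CommGroup G] [TopologicalSpace G]
    {h : G → Circle} {β : SymHom G} (hh : IsSecondDegreeCharacter h β) (z : G) (n : ℕ) :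
    h (z ^ n) = h z ^ n * β.1 z z ^ n.choose 2 := by
  induction n with
  | zero => simp [hh.map_one]
  | succ n ih =>
    have e : (n + 1).choose 2 = n + n.choose 2 := by
      rw [Nat.choose_succ_succ' n 1, Nat.choose_one_right]
    rw [pow_succ, hh.map_mul, ih, _root_.map_pow, e, pow_add (β.1 z z), pow_succ]
    rw [pontryaginDual_pow_apply]
    ac_rfl

theorem exists_zpow_eq_of_pow_eq_one {n : ℕ} (hn : n ≠ 0) {u : Circle} (hu : u ^ (2 * n) = 1) :
    ∃ k : ℤ, u = Circle.exp (Real.pi / n) ^ k := by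
  have h2n : 2 * n ≠ 0 := by positivity
  have : NeZero (2 * n) := ⟨h2n⟩
  have hu' : (u : ℂ) ^ (2 * n) = 1 := by
    rw [← Circle.coe_pow, hu, Circle.coe_one]
  obtain ⟨k, -, hk⟩ := (Complex.isPrimitiveRoot_exp (2 * n) h2n).eq_pow_of_pow_eq_one hu'
  refine ⟨k, Circle.ext ?_⟩
  rw [zpow_natCast, Circle.coe_pow, ← hk, Circle.coe_exp]
  congr 2
  push_cast
  field_simp

variable {A : Type*} [CommGroup A] [TopologicalSpace A] [IsTopologicalGroup A]
  [LocallyCompactSpace A]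

/-- The exponent `2N` is needed because `(2 * N).choose 2` is a multiple of `N`, whereas `N.choose
2` is not for even `N > 0`. -/
theorem IsSecondDegreeCharacter.pow_two_mul_card {K : Subgroup (PhaseSpace A)}
    {hK : IsIsotropic K} {α : K → Circle} (hα : IsSecondDegreeCharacter α (betaPrime K hK))
    (z : K) : α z ^ (2 * Nat.card A) = 1 := by
  set N := Nat.card A
  -- For infinite `A` this is `x ^ 0 = 1`, since then `Nat.card A = 0`.
  have hA (x : A) : x ^ N = 1 := pow_card_eq_one'
  have hξ (ξ : PontryaginDual A) : ξ ^ N = 1 := PontryaginDual.ext fun x => by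
    rw [pontryaginDual_pow_apply, ← _root_.map_pow, hA, _root_.map_one, PontryaginDual.one_apply]
  have hz : z ^ (2 * N) = 1 := by
    refine Subtype.ext (Prod.ext ?_ ?_)
    · show (z : PhaseSpace A).1 ^ (2 * N) = 1
      rw [mul_comm, pow_mul, hA, one_pow]
    · show (z : PhaseSpace A).2 ^ (2 * N) = 1
      rw [mul_comm, pow_mul, hξ, one_pow]
  have hβ : (betaPrime K hK).1 z z ^ (2 * N).choose 2 = 1 := by
    have e : (2 * N).choose 2 = N * (2 * N - 1) := by
      rw [Nat.choose_two_right, mul_assoc, Nat.mul_div_cancel_left _ two_pos]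
    rw [betaPrime_apply, e, pow_mul, inv_pow, ← _root_.map_pow, hA, _root_.map_one, inv_one, one_pow]
  have h := hα.map_pow z (2 * N)
  rwa [hz, hα.map_one, hβ, mul_one, eq_comm] at h

end Finite

end WeylHeisenberg

end

theorem proposition3p3 {A : Type*} [CommGroup A] [TopologicalSpace A] [IsTopologicalGroup A]
    [LocallyCompactSpace A] [T2Space A] [MeasurableSpace A] [BorelSpace A]
    (μ : Measure A) [μ.IsHaarMeasure] [μ.Regular]
    [MeasurableSpace (PontryaginDual A)] [BorelSpace (PontryaginDual A)]
    (ν : Measure (PontryaginDual A)) [ν.IsHaarMeasure] [ν.Regular]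
    (hν : FourierInversion μ ν)
    {ℋ : Type*} [NormedAddCommGroup ℋ] [InnerProductSpace ℂ ℋ]
    (U : ℋ ≃ₗᵢ[ℂ] Lp ℂ 2 μ) :
    (∀ 𝒢 : Set (heisenbergGroup U), 𝒢 ∈ stabilizerClass ν U ↔
      ∃ (K : Subgroup (PhaseSpace A)) (hK : IsMaximalCompactOpenIsotropic K) (α : K → Circle),
        IsSecondDegreeCharacter α (betaPrime K hK.isIsotropic) ∧
        𝒢 = {g | ∃ z : K, g = heisenbergElt U (α z) z}) ∧
    (Finite A → ∀ 𝒢 ∈ stabilizerClass ν U, 𝒢 ⊆ pauliGroup U) := by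
  refine ⟨mem_stabilizerClass_iff U hν, fun _ 𝒢 h𝒢 => ?_⟩
  obtain ⟨K, hK, α, hα, rfl⟩ := (mem_stabilizerClass_iff U hν 𝒢).1 h𝒢
  rintro _ ⟨z, rfl⟩
  obtain ⟨k, hk⟩ := exists_zpow_eq_of_pow_eq_one Nat.card_pos.ne' (hα.pow_two_mul_card z)
  exact ⟨k, z, by rw [hk]⟩
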